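/- Let $n\in\mathbb N$ and let $m^{(1)},\dots,m^{(n)},q^{(1)},\dots,q^{(n)}$ be sequences $(r_p)_{p\ge 0}$ of positive real numbers, each of which satisfies (A0) $r_0=r_1=1$; (A1) $r_p^2\le r_{p-1}r_{p+1}$ for all $p\ge 1$; (A2) there is $H>0$ with $r_{p+s}\le H^{p+s}r_p r_s$ for all $p,s\ge 0$; and suppose that for every $j\in\{1,\dots,n\}$ (A3) there is $L\ge 1$ with $p\,m^{(j)}_{p-1}q^{(j)}_{p-1}\le L\,m^{(j)}_p q^{(j)}_p$ for all $p\ge 1$. For $\alpha,\beta\in\mathbb N^n$ (with $0\in\mathbb N$) put $|\alpha|=\alpha_1+\dots+\alpha_n$, $x^\alpha=x_1^{\alpha_1}\cdots x_n^{\alpha_n}$, $\partial^\beta=\partial_{x_1}^{\beta_1}\cdots\partial_{x_n}^{\beta_n}$, $m_\alpha=m^{(1)}_{\alpha_1}\cdots m^{(n)}_{\alpha_n}$ and $q_\beta=q^{(1)}_{\beta_1}\cdots q^{(n)}_{\beta_n}$. Let $\mathcal S$ be the Schwartz space of rapidly decreasing smooth functions $\mathbb R^n\to\mathbb C$. The Gelfand–Shilov–Roumieu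 space $\mathcal S^q_m$ is the set of all $\varphi\in\mathcal S$ for which there are $C,A,B>0$ with $$|x^\alpha\partial^\beta\varphi(x)|\le C A^{|\alpha|}B^{|\beta|}m_\alpha q_\beta\qquad\text{for all }x\in\mathbb R^n,\ \alpha,\beta\in\mathbb N^n .$$ 1. (Chung–Chung–Kim) For every $\varphi:\mathbb R^n\to\mathbb C$: $\varphi\in\mathcal S^q_m$ if and only if $\varphi\in\mathcal S$ and there are $C,A,B>0$ such that $$\|x^\alpha\varphi\|_\infty\le C A^{|\alpha|}m_\alpha\quad\text{and}\quad \|\partial^\beta\varphi\|_\infty\le C B^{|\beta|}q_\beta\qquad\text{for all }\alpha,\beta\in\mathbb N^n .$$ 2. For every $\varphi\in\mathcal S$, with $\|\cdot\|$ the norm of $L^2(\mathbb R^n)$: there are $C,A,B>0$ such that $\|x^\alpha\partial^\beta\varphi\|\le CA^{|\alpha|}B^{|\beta|}m_\alpha q_\beta$ for all $\alpha,\beta\in\mathbb N^n$ if and only if there are $C,A,B>0$ such that $\|x^\alpha\varphi\|\le CA^{|\alpha|}m_\alpha$ and $\|\partial^\beta\varphi\|\le CB^{|\beta|}q_\beta$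 for all $\alpha,\beta\in\mathbb N^n$. -/

import Mathlib

open scoped SchwartzMap ENNReal

noncomputable section

namespace GSR

/-- `ℝⁿ` with its Euclidean norm and Lebesgue measure. -/
abbrev RN (n : ℕ) : Type := EuclideanSpace ℝ (Fin n)

/-- The length `|α| = α₁ + … + αₙ` of a multi-index `α ∈ ℕⁿ`. -/
def length {n : ℕ} (α : Fin n → ℕ) : ℕ := ∑ j, α j

/-- The monomial `x^α = x₁^{α₁} ⋯ xₙ^{αₙ}`. -/
def monom {n : ℕ} (α : Fin n → ℕ) (x : RN n) : ℝ := ∏ j, x j ^ α j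

/-- The weight `m_α = m⁽¹⁾_{α₁} ⋯ m⁽ⁿ⁾_{αₙ}` of an `n`-tuple of sequences. -/
def weight {n : ℕ} (m : Fin n → ℕ → ℝ) (α : Fin n → ℕ) : ℝ := ∏ j, m j (α j)

/-- The partial derivative `∂φ/∂x_j`. -/
def partialDeriv {n : ℕ} (j : Fin n) (φ : RN n → ℂ) : RN n → ℂ :=
  fun x => lineDeriv ℝ φ x (EuclideanSpace.single j (1 : ℝ))

/-- The partial derivative `∂^β φ = ∂₁^{β₁} ⋯ ∂ₙ^{βₙ} φ`. -/
def multiDeriv {n : ℕ} (β : Fin n → ℕ) (φ : RN n → ℂ) : RN n → ℂ :=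
  (List.finRange n).foldr (fun j f => (partialDeriv j)^[β j] f) φ

/-- `φ` belongs to the Schwartz space of rapidly decreasing smooth functions. -/
def IsSchwartz {n : ℕ} (φ : RN n → ℂ) : Prop := ∃ f : 𝓢(RN n, ℂ), ⇑f = φ

/-- The Gelfand-Shilov-Roumieu space: the rapidly decreasing `φ` with
`|x^α ∂^β φ(x)| ≤ C A^{|α|} B^{|β|} m_α q_β` for all `x`, `α`, `β`. -/
def gsrSpace {n : ℕ} (m q : Fin n → ℕ → ℝ) : Set (RN n → ℂ) :=
  {φ | IsSchwartz φ ∧ ∃ C A B : ℝ, 0 < C ∧ 0 < A ∧ 0 < B ∧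
    ∀ (x : RN n) (α β : Fin n → ℕ),
      ‖monom α x • multiDeriv β φ x‖ ≤
        C * A ^ length α * B ^ length β * weight m α * weight q β}

/-- Normalization: `m₀ = m₁ = 1`. -/
def A0 (m : ℕ → ℝ) : Prop := m 0 = 1 ∧ m 1 = 1

/-- Logarithmic convexity: `m_p² ≤ m_{p-1} m_{p+1}` for `p ≥ 1`. -/
def A1 (m : ℕ → ℝ) : Prop := ∀ p : ℕ, 1 ≤ p → m p ^ 2 ≤ m (p - 1) * m (p + 1)

/-- Komatsu's ultradifferentiability condition (stability). -/
def A2 (m : ℕ → ℝ) : Prop :=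
  ∃ H : ℝ, 0 < H ∧ ∀ p q : ℕ, m (p + q) ≤ H ^ (p + q) * m p * m q

/-- Nontriviality of the pair: `p m_{p-1} q_{p-1} ≤ L m_p q_p` for `p ≥ 1`. -/
def A3 (m q : ℕ → ℝ) : Prop :=
  ∃ L : ℝ, 1 ≤ L ∧ ∀ p : ℕ, 1 ≤ p → (p : ℝ) * m (p - 1) * q (p - 1) ≤ L * m p * q p

/-- The `L²` norm over `ℝⁿ` with Lebesgue measure. -/
def l2norm {n : ℕ} (f : RN n → ℂ) : ℝ≥0∞ := MeasureTheory.eLpNorm f 2 MeasureTheory.volume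

/-- Joint `L²` bounds: `‖x^α ∂^β φ‖ ≤ C A^{|α|} B^{|β|} m_α q_β`. -/
def JointL2Bounds {n : ℕ} (m q : Fin n → ℕ → ℝ) (φ : RN n → ℂ) : Prop :=
  ∃ C A B : ℝ, 0 < C ∧ 0 < A ∧ 0 < B ∧ ∀ α β : Fin n → ℕ,
    l2norm (fun x => monom α x • multiDeriv β φ x) ≤
      ENNReal.ofReal (C * A ^ length α * B ^ length β * weight m α * weight q β)

/-- Separate `L²` bounds: `‖x^α φ‖ ≤ C A^{|α|} m_α` and `‖∂^β φ‖ ≤ C B^{|β|} q_β`. -/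
def SeparateL2Bounds {n : ℕ} (m q : Fin n → ℕ → ℝ) (φ : RN n → ℂ) : Prop :=
  ∃ C A B : ℝ, 0 < C ∧ 0 < A ∧ 0 < B ∧
    (∀ α : Fin n → ℕ, l2norm (fun x => monom α x • φ x) ≤
      ENNReal.ofReal (C * A ^ length α * weight m α)) ∧
    (∀ β : Fin n → ℕ, l2norm (multiDeriv β φ) ≤
      ENNReal.ofReal (C * B ^ length β * weight q β))

/-- Separate sup-norm bounds:
`‖x^α φ‖_∞ ≤ C A^{|α|} m_α` and `‖∂^β φ‖_∞ ≤ C B^{|β|} q_β`. -/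
def SeparateSupBounds {n : ℕ} (m q : Fin n → ℕ → ℝ) (φ : RN n → ℂ) : Prop :=
  ∃ C A B : ℝ, 0 < C ∧ 0 < A ∧ 0 < B ∧
    (∀ (α : Fin n → ℕ) (x : RN n), ‖monom α x • φ x‖ ≤ C * A ^ length α * weight m α) ∧
    (∀ (β : Fin n → ℕ) (x : RN n), ‖multiDeriv β φ x‖ ≤ C * B ^ length β * weight q β)

end GSR

end

/-! Separate bounds become joint ones by squaring. Monomials are symmetric and derivatives skew for
the real L² pairing, so ‖x^α ∂^β φ‖² = ±⟨∂^β(x^{2α} ∂^β φ), φ⟩. Leibniz expands this into terms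
⟨x^{2α-γ} ∂^{2β-γ} φ, φ⟩ = ⟨∂^{2β-γ} φ, x^{2α-γ} φ⟩, controlled by the separate bounds: by
Cauchy–Schwarz for L² data, by sup norm times L¹ norm for sup data.

The coefficients are binom(β,γ), of sum 2^|β|, times γ! binom(2α,γ). Iterating (A3) gives γ! ≤ L^|γ|
m_γ q_γ, and log-convexity gives m_γ m_{2α-γ} ≤ m_{2α}, likewise for q. Hence the expansion costs
only geometric factors (`deriv_monom_deriv_bound`). By (A2), m_{2α} q_{2β} is at most a geometric
factor times (m_α q_β)², and a square root finishes (`hasJointL2Bounds_of_pairing`).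

Sup bounds need two conversions: decay of order 2n+2 in each coordinate gives L¹ bounds
(`integral_norm_le_of_decay`), and a Sobolev inequality returns from L² to sup
(`norm_le_of_L2_bounds`). (A2) absorbs the index shifts. The converse implications take α = 0 or β =
0. -/

noncomputable section

namespace GSR

open MeasureTheory
open scoped LineDeriv

variable {n : ℕ}

/-! ### Derivatives and monomials as operators on Schwartz functions -/

/-- The partial derivative `∂_j` on the Schwartz space. -/
def schwartzPartial (j : Fin n) (f : 𝓢(RN n, ℂ)) : 𝓢(RN n, ℂ) :=
  ∂_{EuclideanSpace.single j (1 : ℝ)} f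

/-- The partial derivative `∂^β` on the Schwartz space. -/
def schwartzDeriv (β : Fin n → ℕ) (f : 𝓢(RN n, ℂ)) : 𝓢(RN n, ℂ) :=
  (List.finRange n).foldr (fun j g => (schwartzPartial j)^[β j] g) f

/-- Multiplication by `x^α` on the Schwartz space. -/
def schwartzMonom (α : Fin n → ℕ) (f : 𝓢(RN n, ℂ)) : 𝓢(RN n, ℂ) :=
  SchwartzMap.smulLeftCLM ℂ (monom α) f

theorem coe_schwartzPartial (j : Fin n) (f : 𝓢(RN n, ℂ)) :
    ⇑(schwartzPartial j f) = partialDeriv j f :=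
  funext fun _ => SchwartzMap.lineDerivOp_apply _ f _

theorem coe_schwartzPartial_iterate (j : Fin n) (b : ℕ) (f : 𝓢(RN n, ℂ)) :
    ⇑((schwartzPartial j)^[b] f) = (partialDeriv j)^[b] f := by
  induction b with
  | zero => rfl
  | succ b ih => rw [Function.iterate_succ_apply', Function.iterate_succ_apply',
      coe_schwartzPartial, ih]

theorem coe_schwartzDeriv (β : Fin n → ℕ) (f : 𝓢(RN n, ℂ)) :
    ⇑(schwartzDeriv β f) = multiDeriv β f := by
  unfold schwartzDeriv multiDeriv
  induction List.finRange n with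
  | nil => rfl
  | cons j l ih => rw [List.foldr_cons, List.foldr_cons, coe_schwartzPartial_iterate, ih]

theorem monom_hasTemperateGrowth (α : Fin n → ℕ) : (monom α : RN n → ℝ).HasTemperateGrowth := by
  have hcoord (j : Fin n) : (fun x : RN n => x j).HasTemperateGrowth :=
    (EuclideanSpace.proj j : RN n →L[ℝ] ℝ).hasTemperateGrowth
  unfold monom
  induction (Finset.univ : Finset (Fin n)) using Finset.induction_on with
  | empty => exact Function.HasTemperateGrowth.const (1 : ℝ)
  | insert j s hj ih =>
    simp only [Finset.prod_insert hj]
    exact ((hcoord j).pow (α j)).mul ih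

theorem schwartzMonom_apply (α : Fin n → ℕ) (f : 𝓢(RN n, ℂ)) (x : RN n) :
    schwartzMonom α f x = monom α x • f x :=
  SchwartzMap.smulLeftCLM_apply_apply (monom_hasTemperateGrowth α) f x

theorem coe_schwartzMonom (α : Fin n → ℕ) (f : 𝓢(RN n, ℂ)) :
    ⇑(schwartzMonom α f) = fun x => monom α x • f x :=
  funext (schwartzMonom_apply α f)

theorem monom_add (α β : Fin n → ℕ) (x : RN n) : monom (α + β) x = monom α x * monom β x := by
  simp [monom, pow_add, Finset.prod_mul_distrib]

@[simp]
theorem monom_zero (x : RN n) : monom 0 x = 1 := by simp [monom]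

theorem monom_single (j : Fin n) (k : ℕ) (x : RN n) : monom (Pi.single j k) x = x j ^ k := by
  unfold monom
  rw [Finset.prod_eq_single j] <;> simp +contextual

theorem schwartzMonom_schwartzMonom (α β : Fin n → ℕ) (f : 𝓢(RN n, ℂ)) :
    schwartzMonom α (schwartzMonom β f) = schwartzMonom (α + β) f := by
  ext x
  simp [schwartzMonom_apply, monom_add, mul_assoc]

@[simp]
theorem schwartzMonom_zero (f : 𝓢(RN n, ℂ)) : schwartzMonom 0 f = f := by
  ext x
  simp [schwartzMonom_apply]

theorem schwartzPartial_add (j : Fin n) (f g : 𝓢(RN n, ℂ)) :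
    schwartzPartial j (f + g) = schwartzPartial j f + schwartzPartial j g :=
  LineDeriv.lineDerivOp_add _ f g

theorem schwartzPartial_smul (j : Fin n) (c : ℝ) (f : 𝓢(RN n, ℂ)) :
    schwartzPartial j (c • f) = c • schwartzPartial j f :=
  LineDeriv.lineDerivOp_smul _ c f

theorem schwartzPartial_iterate_add (j : Fin n) (b : ℕ) (f g : 𝓢(RN n, ℂ)) :
    (schwartzPartial j)^[b] (f + g) = (schwartzPartial j)^[b] f + (schwartzPartial j)^[b] g := by
  induction b with
  | zero => rfl
  | succ b ih => simp only [Function.iterate_succ_apply', ih, schwartzPartial_add]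

theorem schwartzPartial_iterate_smul (j : Fin n) (b : ℕ) (c : ℝ) (f : 𝓢(RN n, ℂ)) :
    (schwartzPartial j)^[b] (c • f) = c • (schwartzPartial j)^[b] f := by
  induction b with
  | zero => rfl
  | succ b ih => simp only [Function.iterate_succ_apply', ih, schwartzPartial_smul]

theorem schwartzDeriv_add (β : Fin n → ℕ) (f g : 𝓢(RN n, ℂ)) :
    schwartzDeriv β (f + g) = schwartzDeriv β f + schwartzDeriv β g := by
  unfold schwartzDeriv
  induction List.finRange n with
  | nil => rfl
  | cons j l ih => simp only [List.foldr_cons, ih, schwartzPartial_iterate_add]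

theorem schwartzDeriv_smul (β : Fin n → ℕ) (c : ℝ) (f : 𝓢(RN n, ℂ)) :
    schwartzDeriv β (c • f) = c • schwartzDeriv β f := by
  unfold schwartzDeriv
  induction List.finRange n with
  | nil => rfl
  | cons j l ih => simp only [List.foldr_cons, ih, schwartzPartial_iterate_smul]

-- The Fourier transform is injective and turns both derivatives into multiplications, which
-- commute.
open scoped FourierTransform in
theorem schwartzPartial_comm (j k : Fin n) :
    Function.Commute (schwartzPartial (n := n) j) (schwartzPartial k) := by
  intro f
  have hinj : Function.Injective (𝓕 : 𝓢(RN n, ℂ) → 𝓢(RN n, ℂ)) :=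
    Function.LeftInverse.injective (g := 𝓕⁻) fun f => FourierTransform.fourierInv_fourier_eq f
  apply hinj
  have hg (v : RN n) : (inner ℝ · v).HasTemperateGrowth :=
    Function.hasTemperateGrowth_inner_left v
  ext x
  simp only [schwartzPartial, SchwartzMap.fourier_lineDerivOp_eq, smul_apply,
    SchwartzMap.smulLeftCLM_apply_apply (hg _), smul_eq_mul, Complex.real_smul]
  ring

theorem schwartzPartial_foldr (k : Fin n) (β : Fin n → ℕ) (l : List (Fin n)) (f : 𝓢(RN n, ℂ)) :
    l.foldr (fun j g => (schwartzPartial j)^[β j] g) (schwartzPartial k f) =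
      schwartzPartial k (l.foldr (fun j g => (schwartzPartial j)^[β j] g) f) := by
  induction l with
  | nil => rfl
  | cons j l ih =>
    rw [List.foldr_cons, List.foldr_cons, ih, (schwartzPartial_comm j k).iterate_left]

theorem schwartzDeriv_schwartzPartial (k : Fin n) (β : Fin n → ℕ) (f : 𝓢(RN n, ℂ)) :
    schwartzDeriv β (schwartzPartial k f) = schwartzPartial k (schwartzDeriv β f) :=
  schwartzPartial_foldr k β _ f

/-- An arbitrary duplicate-free list makes the induction possible: the extra derivative occurs at
most once and commutes to the front. -/
theorem schwartzPartial_foldr_add_single (k : Fin n) (β : Fin n → ℕ) (l : List (Fin n))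
    (hl : l.Nodup) (f : 𝓢(RN n, ℂ)) :
    l.foldr (fun j g => (schwartzPartial j)^[(β + Pi.single k 1 : Fin n → ℕ) j] g) f =
      if k ∈ l then schwartzPartial k (l.foldr (fun j g => (schwartzPartial j)^[β j] g) f)
      else l.foldr (fun j g => (schwartzPartial j)^[β j] g) f := by
  induction l with
  | nil => rfl
  | cons j l ih =>
    rw [List.nodup_cons] at hl
    rw [List.foldr_cons, List.foldr_cons, ih hl.2]
    by_cases hjk : k = j
    · subst hjk
      simp [hl.1, Function.iterate_succ_apply']
    · have : (β + Pi.single k 1 : Fin n → ℕ) j = β j := by simp [Ne.symm hjk]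
      rw [this]
      by_cases hk : k ∈ l
      · simp only [hk, if_true, List.mem_cons, or_true]
        exact (schwartzPartial_comm j k).iterate_left _ _
      · simp [hk, hjk]

theorem schwartzDeriv_add_single (k : Fin n) (β : Fin n → ℕ) (f : 𝓢(RN n, ℂ)) :
    schwartzDeriv (β + Pi.single k 1) f = schwartzPartial k (schwartzDeriv β f) := by
  unfold schwartzDeriv
  rw [schwartzPartial_foldr_add_single k β _ (List.nodup_finRange n), if_pos (List.mem_finRange k)]

@[simp]
theorem schwartzDeriv_zero (f : 𝓢(RN n, ℂ)) : schwartzDeriv 0 f = f := by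
  unfold schwartzDeriv
  induction List.finRange n with
  | nil => rfl
  | cons j l ih => rw [List.foldr_cons, ih]; rfl

theorem schwartzDeriv_single (k : Fin n) (b : ℕ) (f : 𝓢(RN n, ℂ)) :
    schwartzDeriv (Pi.single k b) f = (schwartzPartial k)^[b] f := by
  induction b with
  | zero => simp
  | succ b ih =>
    rw [Pi.single_add, schwartzDeriv_add_single, ih, Function.iterate_succ_apply']

/-! ### Multi-index induction and the Leibniz expansion -/

/-- Induction on a multi-index by raising one coordinate at a time. -/
theorem multiIndex_induction {P : (Fin n → ℕ) → Prop} (β : Fin n → ℕ) (zero : P 0)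
    (succ : ∀ β k, P β → P (β + Pi.single k 1)) : P β := by
  induction h : ∑ j, β j generalizing β with
  | zero =>
    have : β = 0 := funext fun j => by simpa using (Finset.sum_eq_zero_iff.mp h) j (Finset.mem_univ j)
    rwa [this]
  | succ N ih =>
    obtain ⟨k, hk⟩ : ∃ k, β k ≠ 0 := by
      by_contra! hβ
      simp [hβ] at h
    have hle : Pi.single k 1 ≤ β := by
      intro j
      by_cases hj : j = k
      · subst hj; simpa using Nat.one_le_iff_ne_zero.mpr hk
      · simp [hj]
    have hβ : β - Pi.single k 1 + Pi.single k 1 = β := tsub_add_cancel_of_le hle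
    rw [← hβ]
    apply succ
    apply ih
    rw [← hβ] at h
    simpa [Finset.sum_add_distrib] using h

/-- If `α k = 0` the subtraction truncates, harmlessly, since the coefficient vanishes. -/
theorem schwartzPartial_schwartzMonom (k : Fin n) (α : Fin n → ℕ) (f : 𝓢(RN n, ℂ)) :
    schwartzPartial k (schwartzMonom α f) =
      schwartzMonom α (schwartzPartial k f) +
        (α k : ℝ) • schwartzMonom (α - Pi.single k 1) f := by
  ext x
  have hm : HasLineDerivAt ℝ (monom α) ((α k : ℝ) * monom (α - Pi.single k 1) x) x
      (EuclideanSpace.single k (1 : ℝ)) := by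
    have h1 (y : RN n) : monom α y = y k ^ α k * ∏ j ∈ Finset.univ.erase k, y j ^ α j :=
      (Finset.mul_prod_erase _ _ (Finset.mem_univ k)).symm
    have h2 : monom (α - Pi.single k 1) x =
        x k ^ (α k - 1) * ∏ j ∈ Finset.univ.erase k, x j ^ α j := by
      unfold monom
      rw [← Finset.mul_prod_erase _ _ (Finset.mem_univ k)]
      congr 1
      · simp
      · refine Finset.prod_congr rfl fun j hj => ?_
        simp [Finset.ne_of_mem_erase hj]
    have h3 (t : ℝ) : monom α (x + t • EuclideanSpace.single k (1 : ℝ)) =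
        (x k + t) ^ α k * ∏ j ∈ Finset.univ.erase k, x j ^ α j := by
      rw [h1]
      congr 1
      · simp
      · refine Finset.prod_congr rfl fun j hj => ?_
        simp [Finset.ne_of_mem_erase hj]
    unfold HasLineDerivAt
    simp only [h3, h2]
    have := ((((hasDerivAt_id (0 : ℝ)).const_add (x k)).pow (α k)).mul_const
      (∏ j ∈ Finset.univ.erase k, x j ^ α j))
    exact this.congr_deriv (by simp [mul_assoc])
  have hf : HasLineDerivAt ℝ f (schwartzPartial k f x) x (EuclideanSpace.single k (1 : ℝ)) := by
    rw [coe_schwartzPartial]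
    exact (f.differentiableAt.lineDifferentiableAt).hasLineDerivAt
  have hmf : HasLineDerivAt ℝ (fun y => monom α y • f y)
      (monom α x • schwartzPartial k f x +
        ((α k : ℝ) * monom (α - Pi.single k 1) x) • f x) x (EuclideanSpace.single k (1 : ℝ)) := by
    have := HasDerivAt.smul hm hf
    simp only [zero_smul, add_zero] at this
    exact this
  rw [coe_schwartzPartial, partialDeriv, coe_schwartzMonom, hmf.lineDeriv]
  simp [schwartzMonom_apply, mul_assoc]

/-- A bound for `∂^b x^a ∂^{b'} ψ` in terms of the summands of its Leibniz expansion. -/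
theorem leibniz_bound {p : 𝓢(RN n, ℂ) → ℝ} (hadd : ∀ f g, p (f + g) ≤ p f + p g)
    (hsmul : ∀ (c : ℝ) f, 0 ≤ c → p (c • f) ≤ c * p f) (ψ : 𝓢(RN n, ℂ)) (a b b' : Fin n → ℕ)
    {M : ℝ} (hM : 0 ≤ M)
    (h : ∀ γ ≤ b, ((∏ j, (a j).descFactorial (γ j) : ℕ) : ℝ) *
      p (schwartzMonom (a - γ) (schwartzDeriv (b + b' - γ) ψ)) ≤ M) :
    p (schwartzDeriv b (schwartzMonom a (schwartzDeriv b' ψ))) ≤ 2 ^ length b * M := by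
  -- Of the two product-rule terms, one moves a derivative into `b'`; the other lowers `a` and
  -- replaces `M` by `M / a k`. Each step doubles the bound, which accounts for the binomial
  -- coefficients.
  induction b using multiIndex_induction generalizing a b' M with
  | zero => simpa [length] using h 0 le_rfl
  | succ c k ih =>
    rw [schwartzDeriv_add_single, ← schwartzDeriv_schwartzPartial, schwartzPartial_schwartzMonom,
      schwartzDeriv_add, schwartzDeriv_smul]
    have hlen : length (c + Pi.single k 1) = length c + 1 := by
      simp [length, Finset.sum_add_distrib]
    have h1 : p (schwartzDeriv c (schwartzMonom a (schwartzPartial k (schwartzDeriv b' ψ)))) ≤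
        2 ^ length c * M := by
      rw [← schwartzDeriv_add_single]
      refine ih a _ hM fun γ hγ => ?_
      have := h γ (hγ.trans le_self_add)
      rwa [show c + Pi.single k 1 + b' = c + (b' + Pi.single k 1) by abel] at this
    have h2 : p ((a k : ℝ) • schwartzDeriv c (schwartzMonom (a - Pi.single k 1)
        (schwartzDeriv b' ψ))) ≤ 2 ^ length c * M := by
      refine (hsmul _ _ (Nat.cast_nonneg _)).trans ?_
      rcases Nat.eq_zero_or_pos (a k) with hk | hk
      · rw [hk, Nat.cast_zero, zero_mul]; positivity
      have hk' : (0 : ℝ) < a k := Nat.cast_pos.mpr hk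
      have := ih (a - Pi.single k 1) b' (M := M / a k) (by positivity) fun γ hγ => by
        have h3 := h (γ + Pi.single k 1) (add_le_add_left hγ _)
        -- The first factor `a k` of the falling factorial is the coefficient produced by the
        -- product rule.
        have h4 : ∏ j, (a j).descFactorial ((γ + Pi.single k 1 : Fin n → ℕ) j) =
            a k * ∏ j, ((a - Pi.single k 1 : Fin n → ℕ) j).descFactorial (γ j) := by
          rw [← Finset.mul_prod_erase _ _ (Finset.mem_univ k),
            ← Finset.mul_prod_erase (a := k) _ _ (Finset.mem_univ k), ← mul_assoc]
          congr 1
          · obtain ⟨d, hd⟩ := Nat.exists_eq_succ_of_ne_zero hk.ne'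
            simp [hd, Nat.succ_descFactorial_succ, -Nat.descFactorial_succ]
          · refine Finset.prod_congr rfl fun j hj => ?_
            simp [Finset.ne_of_mem_erase hj]
        have h5 : a - (γ + Pi.single k 1) = a - Pi.single k 1 - γ := by
          rw [add_comm, tsub_add_eq_tsub_tsub]
        have h6 : c + Pi.single k 1 + b' - (γ + Pi.single k 1) = c + b' - γ := by
          rw [add_right_comm, add_tsub_add_eq_tsub_right]
        rw [h4, h5, h6] at h3
        rw [le_div_iff₀ hk']
        push_cast at h3 ⊢
        linarith
      calc (a k : ℝ) * _ ≤ a k * (2 ^ length c * (M / a k)) := by gcongr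
        _ = 2 ^ length c * M := by field_simp
    calc _ ≤ _ := hadd _ _
      _ ≤ 2 ^ length c * M + 2 ^ length c * M := add_le_add h1 h2
      _ = _ := by rw [hlen]; ring

/-! ### Consequences of (A1) and (A3) for one pair of sequences -/

section Sequences

variable {r m q : ℕ → ℝ}

theorem ratio_monotone (hpos : ∀ p, 0 < r p) (h1 : A1 r) :
    Monotone fun p => r (p + 1) / r p := by
  refine monotone_nat_of_le_succ fun p => ?_
  have h := h1 (p + 1) (by lia)
  rw [Nat.add_sub_cancel] at h
  rw [div_le_div_iff₀ (hpos _) (hpos _)]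
  linarith

/-- Log-convexity makes `r (p + 1) / r p` nondecreasing, so raising `b` by one multiplies the right
side by at least as much as the left. -/
theorem mul_le_of_logConvex (hpos : ∀ p, 0 < r p) (h0 : A0 r) (h1 : A1 r) (a b : ℕ) :
    r a * r b ≤ r (a + b) := by
  induction b with
  | zero => simp [h0.1]
  | succ b ih =>
    have hrat : r (b + 1) / r b ≤ r (a + b + 1) / r (a + b) :=
      ratio_monotone hpos h1 (Nat.le_add_left b a)
    calc r a * r (b + 1) = r a * r b * (r (b + 1) / r b) := by
          field_simp [(hpos b).ne']
      _ ≤ r (a + b) * (r (a + b + 1) / r (a + b)) :=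
          mul_le_mul ih hrat (div_pos (hpos _) (hpos _)).le (hpos _).le
      _ = r (a + (b + 1)) := by
          rw [mul_div_cancel₀ _ (hpos _).ne', add_assoc]

theorem factorial_le (hm0 : A0 m) (hq0 : A0 q) {L : ℝ} (hL : 0 ≤ L)
    (h3 : ∀ p : ℕ, 1 ≤ p → (p : ℝ) * m (p - 1) * q (p - 1) ≤ L * m p * q p) (c : ℕ) :
    (c.factorial : ℝ) ≤ L ^ c * (m c * q c) := by
  induction c with
  | zero => simp [hm0.1, hq0.1]
  | succ c ih =>
    have h := h3 (c + 1) (by lia)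
    rw [Nat.add_sub_cancel] at h
    rw [Nat.factorial_succ, Nat.cast_mul]
    calc ((c + 1 : ℕ) : ℝ) * (c.factorial : ℝ) ≤ ((c + 1 : ℕ) : ℝ) * (L ^ c * (m c * q c)) := by
          gcongr
      _ = L ^ c * (((c + 1 : ℕ) : ℝ) * m c * q c) := by ring
      _ ≤ L ^ c * (L * m (c + 1) * q (c + 1)) := by gcongr
      _ = L ^ (c + 1) * (m (c + 1) * q (c + 1)) := by ring

/-- The falling factorial is `c!` times a binomial coefficient. (A3) trades `c!` for `m c * q c`,
which log-convexity merges with the lowered terms. -/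
theorem descFactorial_mul_le (hm : ∀ p, 0 < m p) (hq : ∀ p, 0 < q p) (hm0 : A0 m) (hq0 : A0 q)
    (hm1 : A1 m) (hq1 : A1 q) {L : ℝ} (hL : 0 ≤ L)
    (h3 : ∀ p : ℕ, 1 ≤ p → (p : ℝ) * m (p - 1) * q (p - 1) ≤ L * m p * q p)
    {a c t : ℕ} (hct : c ≤ t) :
    (a.descFactorial c : ℝ) * (m (a - c) * q (t - c)) ≤ 2 ^ a * L ^ c * (m a * q t) := by
  -- For `a < c` the index `a - c` truncates, but the falling factorial is zero.
  rcases lt_or_ge a c with hac | hca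
  · rw [Nat.descFactorial_of_lt hac, Nat.cast_zero, zero_mul]
    have := hm a
    have := hq t
    positivity
  have hma := mul_le_of_logConvex hm hm0 hm1 c (a - c)
  have hqt := mul_le_of_logConvex hq hq0 hq1 c (t - c)
  rw [Nat.add_sub_cancel' hca] at hma
  rw [Nat.add_sub_cancel' hct] at hqt
  have hchoose : (a.choose c : ℝ) ≤ 2 ^ a := by exact_mod_cast Nat.choose_le_two_pow a c
  have hfac := factorial_le hm0 hq0 hL h3 c
  have h1 := hm (a - c)
  have h2 := hq (t - c)
  have h4 := hm c
  have h5 := hq c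
  rw [Nat.descFactorial_eq_factorial_mul_choose, Nat.cast_mul]
  calc (c.factorial : ℝ) * (a.choose c) * (m (a - c) * q (t - c))
      ≤ (L ^ c * (m c * q c)) * 2 ^ a * (m (a - c) * q (t - c)) := by gcongr
    _ = 2 ^ a * L ^ c * ((m c * m (a - c)) * (q c * q (t - c))) := by ring
    _ ≤ 2 ^ a * L ^ c * (m a * q t) := by
        have := hm a
        gcongr

end Sequences

/-! ### Multi-index weights with uniform constants -/

section Weights

variable {m q : Fin n → ℕ → ℝ}

theorem length_add (α β : Fin n → ℕ) : length (α + β) = length α + length β :=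
  Finset.sum_add_distrib

theorem length_mono : Monotone (length (n := n)) := fun _ _ h =>
  Finset.sum_le_sum fun j _ => h j

@[simp]
theorem length_zero : length (0 : Fin n → ℕ) = 0 := Finset.sum_const_zero

@[simp]
theorem length_single (j : Fin n) (k : ℕ) : length (Pi.single j k) = k :=
  Finset.sum_pi_single' j k Finset.univ |>.trans (by simp)

theorem weight_pos (hm : ∀ j p, 0 < m j p) (α : Fin n → ℕ) : 0 < weight m α :=
  Finset.prod_pos fun j _ => hm j _

theorem weight_zero (hm0 : ∀ j, A0 (m j)) : weight m 0 = 1 :=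
  Finset.prod_eq_one fun j _ => (hm0 j).1

theorem weight_single (hm0 : ∀ j, A0 (m j)) (j : Fin n) (k : ℕ) :
    weight m (Pi.single j k) = m j k := by
  unfold weight
  rw [Finset.prod_eq_single j] <;> simp +contextual [(hm0 _).1]

theorem exists_uniform_A2 (hm : ∀ j p, 0 < m j p) (hm2 : ∀ j, A2 (m j)) :
    ∃ H : ℝ, 1 ≤ H ∧ ∀ α β : Fin n → ℕ,
      weight m (α + β) ≤ H ^ length (α + β) * (weight m α * weight m β) := by
  choose K hK h2 using hm2
  have hsum : 0 ≤ ∑ j, K j := Finset.sum_nonneg fun j _ => (hK j).le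
  -- The sum dominates every `K j`; the summand 1 gives `1 ≤ H` even for `n = 0`.
  refine ⟨1 + ∑ j, K j, by linarith, fun α β => ?_⟩
  unfold length weight
  rw [← Finset.prod_pow_eq_pow_sum, ← Finset.prod_mul_distrib, ← Finset.prod_mul_distrib]
  refine Finset.prod_le_prod (fun j _ => (hm j _).le) fun j _ => (h2 j (α j) (β j)).trans ?_
  have hle : K j ≤ 1 + ∑ i, K i := by
    linarith [Finset.single_le_sum (fun i _ => (hK i).le) (Finset.mem_univ j)]
  have := hm j (α j)
  have := hm j (β j)
  have := (hK j).le
  rw [← mul_assoc, Pi.add_apply]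
  gcongr

theorem exists_uniform_A3 (hm : ∀ j p, 0 < m j p) (hq : ∀ j p, 0 < q j p)
    (hm0 : ∀ j, A0 (m j)) (hq0 : ∀ j, A0 (q j)) (hm1 : ∀ j, A1 (m j)) (hq1 : ∀ j, A1 (q j))
    (h3 : ∀ j, A3 (m j) (q j)) :
    ∃ L : ℝ, 1 ≤ L ∧ ∀ a c t : Fin n → ℕ, c ≤ t →
      ((∏ j, (a j).descFactorial (c j) : ℕ) : ℝ) * (weight m (a - c) * weight q (t - c)) ≤
        2 ^ length a * L ^ length c * (weight m a * weight q t) := by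
  choose K hK h3 using h3
  have hsum : 0 ≤ ∑ j, K j := Finset.sum_nonneg fun j _ => zero_le_one.trans (hK j)
  refine ⟨1 + ∑ j, K j, by linarith, fun a c t hct => ?_⟩
  unfold length weight
  push_cast
  rw [← Finset.prod_pow_eq_pow_sum, ← Finset.prod_pow_eq_pow_sum]
  simp only [← Finset.prod_mul_distrib]
  refine Finset.prod_le_prod (fun j _ => ?_) fun j _ => ?_
  · exact mul_nonneg (Nat.cast_nonneg _) (mul_pos (hm j _) (hq j _)).le
  refine (descFactorial_mul_le (hm j) (hq j) (hm0 j) (hq0 j) (hm1 j) (hq1 j)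
    (zero_le_one.trans (hK j)) (h3 j) (hct j)).trans ?_
  have hle : K j ≤ 1 + ∑ i, K i := by
    linarith [Finset.single_le_sum (fun i _ => zero_le_one.trans (hK i)) (Finset.mem_univ j)]
  have := hm j (a j)
  have := hq j (t j)
  have := zero_le_one.trans (hK j)
  gcongr

/-- Bounds for `x^a ∂^t φ` give bounds for `∂^b x^a ∂^{b'} φ`. -/
theorem deriv_monom_deriv_bound (hm : ∀ j p, 0 < m j p) (hq : ∀ j p, 0 < q j p) {L : ℝ}
    (hL : 1 ≤ L)
    (h3 : ∀ a c t : Fin n → ℕ, c ≤ t →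
      ((∏ j, (a j).descFactorial (c j) : ℕ) : ℝ) * (weight m (a - c) * weight q (t - c)) ≤
        2 ^ length a * L ^ length c * (weight m a * weight q t))
    {p : 𝓢(RN n, ℂ) → ℝ} (hadd : ∀ f g, p (f + g) ≤ p f + p g)
    (hsmul : ∀ (c : ℝ) f, 0 ≤ c → p (c • f) ≤ c * p f) {φ : 𝓢(RN n, ℂ)} {C A B : ℝ}
    (hC : 0 ≤ C) (hA : 1 ≤ A) (hB : 1 ≤ B)
    (h : ∀ a t, p (schwartzMonom a (schwartzDeriv t φ)) ≤
      C * A ^ length a * B ^ length t * (weight m a * weight q t)) (a b b' : Fin n → ℕ) :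
    p (schwartzDeriv b (schwartzMonom a (schwartzDeriv b' φ))) ≤
      C * (2 * A) ^ length a * (2 * L) ^ length b * B ^ length (b + b') *
        (weight m a * weight q (b + b')) := by
  have hwa := weight_pos hm a
  have hwt := weight_pos hq (b + b')
  -- `M` must not depend on `c`, so powers of `A`, `B`, `L` are raised to their largest exponents;
  -- this uses that all three are at least 1.
  have key := leibniz_bound hadd hsmul φ a b b'
    (M := C * (2 * A) ^ length a * L ^ length b * B ^ length (b + b') *
        (weight m a * weight q (b + b'))) (by positivity) fun c hc => by
    have hct : c ≤ b + b' := hc.trans le_self_add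
    have h3' := h3 a c (b + b') hct
    have hp1 := weight_pos hm (a - c)
    have hp2 := weight_pos hq (b + b' - c)
    have e1 : A ^ length (a - c) ≤ A ^ length a :=
      pow_le_pow_right₀ hA (length_mono tsub_le_self)
    have e2 : B ^ length (b + b' - c) ≤ B ^ length (b + b') :=
      pow_le_pow_right₀ hB (length_mono tsub_le_self)
    have e3 : L ^ length c ≤ L ^ length b := pow_le_pow_right₀ hL (length_mono hc)
    calc ((∏ j, (a j).descFactorial (c j) : ℕ) : ℝ) *
          p (schwartzMonom (a - c) (schwartzDeriv (b + b' - c) φ))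
        ≤ ((∏ j, (a j).descFactorial (c j) : ℕ) : ℝ) * (C * A ^ length (a - c) *
          B ^ length (b + b' - c) * (weight m (a - c) * weight q (b + b' - c))) := by
            gcongr; exact h _ _
      _ ≤ ((∏ j, (a j).descFactorial (c j) : ℕ) : ℝ) * (C * A ^ length a *
          B ^ length (b + b') * (weight m (a - c) * weight q (b + b' - c))) := by gcongr
      _ = C * A ^ length a * B ^ length (b + b') * (((∏ j, (a j).descFactorial (c j) : ℕ) : ℝ) *
          (weight m (a - c) * weight q (b + b' - c))) := by ring
      _ ≤ C * A ^ length a * B ^ length (b + b') *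
          (2 ^ length a * L ^ length b * (weight m a * weight q (b + b'))) := by
            refine mul_le_mul_of_nonneg_left (h3'.trans ?_) (by positivity)
            gcongr
      _ = _ := by rw [mul_pow]; ring
  refine key.trans (le_of_eq ?_)
  rw [mul_pow 2 L]
  ring

end Weights

/-! ### The real L² pairing and integration by parts -/

section Pairing

/-- The real `L²` pairing of two Schwartz functions. -/
def pairing (f g : 𝓢(RN n, ℂ)) : ℝ := ∫ x, inner ℝ (f x) (g x)

theorem integrable_inner (f g : 𝓢(RN n, ℂ)) :
    Integrable (fun x => inner ℝ (f x) (g x)) (volume : Measure (RN n)) :=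
  (SchwartzMap.bilinLeftCLM (innerSL ℝ (E := ℂ)) g.hasTemperateGrowth f).integrable

theorem pairing_add_left (f g h : 𝓢(RN n, ℂ)) :
    pairing (f + g) h = pairing f h + pairing g h := by
  unfold pairing
  rw [← integral_add (integrable_inner f h) (integrable_inner g h)]
  simp only [add_apply, inner_add_left]

theorem pairing_smul_left (c : ℝ) (f g : 𝓢(RN n, ℂ)) : pairing (c • f) g = c * pairing f g := by
  unfold pairing
  rw [← integral_const_mul]
  simp only [smul_apply, real_inner_smul_left]

theorem pairing_partial (j : Fin n) (f g : 𝓢(RN n, ℂ)) :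
    pairing f (schwartzPartial j g) = -pairing (schwartzPartial j f) g :=
  SchwartzMap.integral_bilinear_lineDerivOp_right_eq_neg_left f g (innerSL ℝ (E := ℂ)) _

/-- Each integration by parts changes only the sign, and the order of the derivatives is immaterial.
-/
theorem abs_pairing_deriv (β : Fin n → ℕ) (f g : 𝓢(RN n, ℂ)) :
    |pairing f (schwartzDeriv β g)| = |pairing (schwartzDeriv β f) g| := by
  induction β using multiIndex_induction generalizing f with
  | zero => simp
  | succ β k ih =>
    rw [schwartzDeriv_add_single, pairing_partial, abs_neg, ih, schwartzDeriv_add_single,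
      schwartzDeriv_schwartzPartial]

theorem pairing_monom (α : Fin n → ℕ) (f g : 𝓢(RN n, ℂ)) :
    pairing (schwartzMonom α f) g = pairing f (schwartzMonom α g) := by
  unfold pairing
  simp only [schwartzMonom_apply, real_inner_smul_left, real_inner_smul_right]

theorem pairing_eq_re_inner (f g : 𝓢(RN n, ℂ)) :
    pairing f g = (inner ℂ (f.toLp 2 volume) (g.toLp 2 volume)).re := by
  rw [SchwartzMap.inner_toL2_toL2_eq f g volume]
  have hint : Integrable (fun x => inner ℂ (f x) (g x)) (volume : Measure (RN n)) :=
    (L2.integrable_inner (𝕜 := ℂ) (f.toLp 2 volume) (g.toLp 2 volume)).congr (by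
      filter_upwards [f.coeFn_toLp 2 volume, g.coeFn_toLp 2 volume] with x hf hg
      rw [hf, hg])
  exact integral_re (𝕜 := ℂ) hint

theorem pairing_self (f : 𝓢(RN n, ℂ)) : pairing f f = ‖f.toLp 2 volume‖ ^ 2 := by
  rw [pairing_eq_re_inner]
  exact (norm_sq_eq_re_inner (𝕜 := ℂ) _).symm

theorem abs_pairing_le (f g : 𝓢(RN n, ℂ)) :
    |pairing f g| ≤ ‖f.toLp 2 volume‖ * ‖g.toLp 2 volume‖ := by
  rw [pairing_eq_re_inner]
  exact (Complex.abs_re_le_norm _).trans (norm_inner_le_norm _ _)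

theorem abs_pairing_le_of_bound {f g : 𝓢(RN n, ℂ)} {M : ℝ} (hM : ∀ x, ‖f x‖ ≤ M) :
    |pairing f g| ≤ M * ∫ x, ‖g x‖ := by
  rw [← integral_const_mul]
  refine (abs_integral_le_integral_abs).trans ?_
  refine integral_mono (integrable_inner f g).abs (g.integrable.norm.const_mul M) fun x => ?_
  exact (abs_real_inner_le_norm _ _).trans (mul_le_mul_of_nonneg_right (hM x) (norm_nonneg _))

end Pairing

/-! ### Decay weight, L¹ estimate and Sobolev inequality -/

section Integrability

/-- The function `1 + |x₁|^{2n+2} + … + |xₙ|^{2n+2}` on `ℝⁿ`. -/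
def decayWeight (x : RN n) : ℝ := 1 + ∑ j, |x j| ^ (2 * n + 2)

theorem one_le_decayWeight (x : RN n) : 1 ≤ decayWeight x :=
  le_add_of_nonneg_right (Finset.sum_nonneg fun _ _ => by positivity)

theorem norm_le_sum_abs (x : RN n) : ‖x‖ ≤ ∑ j, |x j| := by
  have hx : x = ∑ j, x j • EuclideanSpace.single j (1 : ℝ) := by
    ext i
    simp [Pi.single_apply]
  calc ‖x‖ = ‖∑ j, x j • EuclideanSpace.single j (1 : ℝ)‖ := by rw [← hx]
    _ ≤ ∑ j, ‖x j • EuclideanSpace.single j (1 : ℝ)‖ := norm_sum_le _ _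
    _ = ∑ j, |x j| := by simp [norm_smul]

/-- Power mean inequality for the `n + 1` numbers 1, |x₁|, …, |xₙ|, indexed by `Option (Fin n)`. -/
theorem one_add_norm_pow_le (x : RN n) :
    (1 + ‖x‖) ^ (2 * n + 2) ≤ ((n : ℝ) + 1) ^ (2 * n + 1) * decayWeight x := by
  have h := pow_sum_div_card_le_sum_pow (s := (Finset.univ : Finset (Option (Fin n))))
    (f := fun o => o.elim 1 fun j => |x j|) (by rintro (_ | j) - <;> simp) (2 * n + 1)
  simp only [Fintype.sum_option, Option.elim_none, Option.elim_some, Finset.card_univ,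
    Fintype.card_option, Fintype.card_fin, one_pow, Nat.cast_add, Nat.cast_one] at h
  rw [div_le_iff₀' (by positivity)] at h
  refine le_trans ?_ h
  gcongr
  exact norm_le_sum_abs x

theorem integrable_inv_decayWeight :
    Integrable (fun x : RN n => (decayWeight x)⁻¹) (volume : Measure (RN n)) := by
  have hr : (Module.finrank ℝ (RN n) : ℝ) < ((2 * n + 2 : ℕ) : ℝ) := by
    rw [finrank_euclideanSpace_fin]
    exact_mod_cast (by lia : n < 2 * n + 2)
  have hint := (integrable_one_add_norm (μ := (volume : Measure (RN n))) hr).const_mul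
    (((n : ℝ) + 1) ^ (2 * n + 1))
  refine hint.mono' ?_ (ae_of_all _ fun x => ?_)
  · refine Continuous.aestronglyMeasurable (Continuous.inv₀ ?_ fun x => ?_)
    · unfold decayWeight
      fun_prop
    · linarith [one_le_decayWeight x]
  · have hw := zero_lt_one.trans_le (one_le_decayWeight x)
    rw [Real.norm_eq_abs, abs_of_pos (inv_pos.mpr hw), Real.rpow_neg (by positivity),
      Real.rpow_natCast, ← div_eq_mul_inv, inv_le_comm₀ hw (by positivity), inv_div,
      div_le_iff₀' (by positivity)]
    exact one_add_norm_pow_le x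

/-- Polynomial decay in every coordinate bounds the `L¹` norm. -/
theorem integral_norm_le_of_decay (f : 𝓢(RN n, ℂ)) {M : ℝ} (h0 : ∀ x, ‖f x‖ ≤ M)
    (h : ∀ j x, ‖schwartzMonom (Pi.single j (2 * n + 2)) f x‖ ≤ M) :
    ∫ x, ‖f x‖ ≤ ((n : ℝ) + 1) * M * ∫ x : RN n, (decayWeight x)⁻¹ := by
  rw [← integral_const_mul]
  refine integral_mono f.integrable.norm (integrable_inv_decayWeight.const_mul _) fun x => ?_
  have hw := zero_lt_one.trans_le (one_le_decayWeight x)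
  simp only
  rw [← div_eq_mul_inv, le_div_iff₀ hw, decayWeight, mul_add, mul_one, Finset.mul_sum, add_mul,
    add_comm, one_mul]
  refine add_le_add ?_ (h0 x)
  calc ∑ j, ‖f x‖ * |x j| ^ (2 * n + 2) ≤ ∑ _j : Fin n, M := by
        refine Finset.sum_le_sum fun j _ => ?_
        have := h j x
        rwa [schwartzMonom_apply, monom_single, norm_smul, norm_pow, Real.norm_eq_abs,
          mul_comm] at this
    _ = n * M := by simp

open scoped FourierTransform

theorem norm_le_integral_norm_fourier (f : 𝓢(RN n, ℂ)) (x : RN n) :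
    ‖f x‖ ≤ ∫ ξ, ‖𝓕 f ξ‖ := by
  have h : f x = 𝓕 (𝓕 f) (-x) := by
    have hinv : 𝓕⁻ (𝓕 f) = f := FourierTransform.fourierInv_fourier_eq f
    conv_lhs => rw [← hinv]
    rw [SchwartzMap.fourierInv_apply_eq]
    rfl
  rw [h, ← SchwartzMap.norm_toLp_one]
  exact SchwartzMap.norm_fourier_apply_le_toLp_one _ _

/-- Each derivative contributes a factor 2π|ξ_j|, and 2π ≥ 1 is dropped. -/
theorem abs_pow_mul_norm_fourier_le (j : Fin n) (s : ℕ) (f : 𝓢(RN n, ℂ)) (ξ : RN n) :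
    |ξ j| ^ s * ‖𝓕 f ξ‖ ≤ ‖𝓕 ((schwartzPartial j)^[s] f) ξ‖ := by
  induction s with
  | zero => simp
  | succ s ih =>
    have hg (v : RN n) : (inner ℝ · v).HasTemperateGrowth :=
      Function.hasTemperateGrowth_inner_left v
    have hpi : (1 : ℝ) ≤ 2 * Real.pi := by linarith [Real.pi_gt_three]
    rw [Function.iterate_succ_apply', schwartzPartial, SchwartzMap.fourier_lineDerivOp_eq,
      smul_apply, SchwartzMap.smulLeftCLM_apply_apply (hg _), norm_smul, norm_smul]
    have hξ : ‖inner ℝ ξ (EuclideanSpace.single j (1 : ℝ))‖ = |ξ j| := by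
      simp [EuclideanSpace.inner_single_right]
    have hc : ‖(2 * Real.pi * Complex.I : ℂ)‖ = 2 * Real.pi := by
      simp [abs_of_pos Real.pi_pos]
    rw [hξ, hc]
    calc |ξ j| ^ (s + 1) * ‖𝓕 f ξ‖ = |ξ j| * (|ξ j| ^ s * ‖𝓕 f ξ‖) := by ring
      _ ≤ |ξ j| * ‖𝓕 ((schwartzPartial j)^[s] f) ξ‖ := by gcongr
      _ ≤ _ := le_mul_of_one_le_left (by positivity) hpi

theorem integral_norm_sq_eq (f : 𝓢(RN n, ℂ)) : ∫ x, ‖f x‖ ^ 2 = ‖f.toLp 2 volume‖ ^ 2 := by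
  rw [← pairing_self]
  simp only [pairing, real_inner_self_eq_norm_sq]

theorem integrable_norm_sq (f : 𝓢(RN n, ℂ)) :
    Integrable (fun x => ‖f x‖ ^ 2) (volume : Measure (RN n)) := by
  simpa only [real_inner_self_eq_norm_sq] using integrable_inner f f

/-- A Sobolev inequality with pure derivatives of order `n + 1`. -/
theorem norm_le_of_L2_bounds (f : 𝓢(RN n, ℂ)) {G : ℝ} (hG : 0 < G)
    (h0 : ‖f.toLp 2 volume‖ ≤ G)
    (h : ∀ j, ‖((schwartzPartial j)^[n + 1] f).toLp 2 volume‖ ≤ G) (x : RN n) :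
    ‖f x‖ ≤ ((∫ x : RN n, (decayWeight x)⁻¹) + (n + 1)) * G := by
  refine (norm_le_integral_norm_fourier f x).trans ?_
  let D (j : Fin n) : 𝓢(RN n, ℂ) := 𝓕 ((schwartzPartial j)^[n + 1] f)
  have hpt (ξ : RN n) : ‖𝓕 f ξ‖ ≤
      G * (decayWeight ξ)⁻¹ + G⁻¹ * (‖𝓕 f ξ‖ ^ 2 + ∑ j, ‖D j ξ‖ ^ 2) := by
    have hw := zero_lt_one.trans_le (one_le_decayWeight ξ)
    -- The exponent 2n+2 is twice the order n+1 of the derivatives.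
    have h1 : decayWeight ξ * ‖𝓕 f ξ‖ ^ 2 ≤ ‖𝓕 f ξ‖ ^ 2 + ∑ j, ‖D j ξ‖ ^ 2 := by
      rw [decayWeight, add_mul, one_mul, Finset.sum_mul]
      gcongr with j
      rw [show 2 * n + 2 = (n + 1) * 2 by ring, pow_mul, ← mul_pow]
      exact pow_le_pow_left₀ (by positivity) (abs_pow_mul_norm_fourier_le j (n + 1) f ξ) 2
    -- Weighted AM–GM; `G` balances the terms, since after integration Plancherel makes each a
    -- multiple of `G`.
    have h2 : ‖𝓕 f ξ‖ ≤ G * (decayWeight ξ)⁻¹ + G⁻¹ * (decayWeight ξ * ‖𝓕 f ξ‖ ^ 2) := by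
      set u := ‖𝓕 f ξ‖
      set w := decayWeight ξ
      have hsq : 0 ≤ G⁻¹ * w * ((u - G * w⁻¹ / 2) ^ 2 + 3 / 4 * (G * w⁻¹) ^ 2) := by positivity
      have hid : G * w⁻¹ + G⁻¹ * (w * u ^ 2) - u =
          G⁻¹ * w * ((u - G * w⁻¹ / 2) ^ 2 + 3 / 4 * (G * w⁻¹) ^ 2) := by
        field_simp
        ring
      linarith
    exact h2.trans (by gcongr)
  have hD (j : Fin n) : ∫ ξ, ‖D j ξ‖ ^ 2 ≤ G ^ 2 := by
    rw [SchwartzMap.integral_norm_sq_fourier, integral_norm_sq_eq]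
    exact pow_le_pow_left₀ (norm_nonneg _) (h j) 2
  have hF : ∫ ξ, ‖𝓕 f ξ‖ ^ 2 ≤ G ^ 2 := by
    rw [SchwartzMap.integral_norm_sq_fourier, integral_norm_sq_eq]
    exact pow_le_pow_left₀ (norm_nonneg _) h0 2
  have hDint : Integrable (fun ξ => ∑ j, ‖D j ξ‖ ^ 2) (volume : Measure (RN n)) :=
    integrable_finsetSum _ fun j _ => integrable_norm_sq (D j)
  have hFint := integrable_norm_sq (𝓕 f)
  have hsum : Integrable (fun ξ => G⁻¹ * (‖𝓕 f ξ‖ ^ 2 + ∑ j, ‖D j ξ‖ ^ 2))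
      (volume : Measure (RN n)) := (hFint.add hDint).const_mul G⁻¹
  calc ∫ ξ, ‖𝓕 f ξ‖
      ≤ ∫ ξ, (G * (decayWeight ξ)⁻¹ + G⁻¹ * (‖𝓕 f ξ‖ ^ 2 + ∑ j, ‖D j ξ‖ ^ 2)) :=
        integral_mono (𝓕 f).integrable.norm ((integrable_inv_decayWeight.const_mul G).add hsum) hpt
    _ = G * (∫ ξ : RN n, (decayWeight ξ)⁻¹) +
          G⁻¹ * ((∫ ξ, ‖𝓕 f ξ‖ ^ 2) + ∑ j, ∫ ξ, ‖D j ξ‖ ^ 2) := by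
        rw [integral_add (integrable_inv_decayWeight.const_mul G) hsum, integral_const_mul, integral_const_mul,
          integral_add hFint hDint, integral_finsetSum _ fun j _ => integrable_norm_sq (D j)]
    _ ≤ G * (∫ ξ : RN n, (decayWeight ξ)⁻¹) + G⁻¹ * (G ^ 2 + ∑ _j : Fin n, G ^ 2) := by
        gcongr with j
        exact hD j
    _ = _ := by
        simp only [Finset.sum_const, Finset.card_univ, Fintype.card_fin, nsmul_eq_mul]
        field_simp
        ring

end Integrability

/-! ### From pairings to joint L² bounds, and on to sup bounds -/

variable {m q : Fin n → ℕ → ℝ}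

theorem l2norm_le_ofReal_iff (f : 𝓢(RN n, ℂ)) {c : ℝ} (hc : 0 ≤ c) :
    l2norm f ≤ ENNReal.ofReal c ↔ ‖f.toLp 2 volume‖ ≤ c := by
  rw [SchwartzMap.norm_toLp, l2norm,
    ENNReal.le_ofReal_iff_toReal_le (f.memLp 2 volume).eLpNorm_ne_top hc]

/-- Joint bounds `‖x^α ∂^β φ‖ ≤ C A^{|α|} B^{|β|} m_α q_β` in `L²`, with `A, B ≥ 1`. -/
def HasJointL2Bounds (m q : Fin n → ℕ → ℝ) (φ : 𝓢(RN n, ℂ)) : Prop :=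
  ∃ C A B : ℝ, 0 < C ∧ 1 ≤ A ∧ 1 ≤ B ∧ ∀ α β : Fin n → ℕ,
    ‖(schwartzMonom α (schwartzDeriv β φ)).toLp 2 volume‖ ≤
      C * A ^ length α * B ^ length β * (weight m α * weight q β)

theorem hasJointL2Bounds_of_pairing (hm : ∀ j p, 0 < m j p) (hq : ∀ j p, 0 < q j p)
    (hm0 : ∀ j, A0 (m j)) (hq0 : ∀ j, A0 (q j)) (hm1 : ∀ j, A1 (m j)) (hq1 : ∀ j, A1 (q j))
    (hm2 : ∀ j, A2 (m j)) (hq2 : ∀ j, A2 (q j)) (h3 : ∀ j, A3 (m j) (q j))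
    {φ : 𝓢(RN n, ℂ)} {C A B : ℝ} (hC : 0 < C) (hA : 1 ≤ A) (hB : 1 ≤ B)
    (h : ∀ α β, |pairing (schwartzMonom α (schwartzDeriv β φ)) φ| ≤
      C * A ^ length α * B ^ length β * (weight m α * weight q β)) :
    HasJointL2Bounds m q φ := by
  obtain ⟨L, hL, hL3⟩ := exists_uniform_A3 hm hq hm0 hq0 hm1 hq1 h3
  obtain ⟨H, hH, hH2⟩ := exists_uniform_A2 hm hm2
  obtain ⟨K, hK, hK2⟩ := exists_uniform_A2 hq hq2
  have hadd (f g : 𝓢(RN n, ℂ)) : |pairing (f + g) φ| ≤ |pairing f φ| + |pairing g φ| := by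
    rw [pairing_add_left]
    exact abs_add_le _ _
  have hsmul (c : ℝ) (f : 𝓢(RN n, ℂ)) (hc : 0 ≤ c) :
      |pairing (c • f) φ| ≤ c * |pairing f φ| := by
    rw [pairing_smul_left, abs_mul, abs_of_nonneg hc]
  have key := deriv_monom_deriv_bound hm hq hL hL3 (p := fun f => |pairing f φ|)
    hadd hsmul hC.le hA hB h
  -- These constants make the bound a perfect square: C ≤ (1+C)², and the lengths of `α + α` and `β
  -- + β` are even.
  refine ⟨1 + C, 2 * A * H, 2 * L * B * K, by linarith, ?_, ?_, fun α β => ?_⟩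
  · exact one_le_mul_of_one_le_of_one_le (by linarith) hH
  · exact one_le_mul_of_one_le_of_one_le
      (one_le_mul_of_one_le_of_one_le (by linarith) hB) hK
  have hwm := weight_pos hm α
  have hwq := weight_pos hq β
  have hwm2 := weight_pos hm (α + α)
  have hwq2 := weight_pos hq (β + β)
  have hsq : ‖(schwartzMonom α (schwartzDeriv β φ)).toLp 2 volume‖ ^ 2 ≤
      ((1 + C) * (2 * A * H) ^ length α * (2 * L * B * K) ^ length β *
        (weight m α * weight q β)) ^ 2 := by
    rw [← pairing_self, ← pairing_monom, schwartzMonom_schwartzMonom]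
    refine (le_abs_self _).trans ?_
    rw [abs_pairing_deriv]
    calc |pairing (schwartzDeriv β (schwartzMonom (α + α) (schwartzDeriv β φ))) φ|
        ≤ C * (2 * A) ^ length (α + α) * (2 * L) ^ length β * B ^ length (β + β) *
          (weight m (α + α) * weight q (β + β)) := key _ _ _
      _ ≤ (1 + C) ^ 2 * (2 * A) ^ length (α + α) * (2 * L) ^ (length (β + β)) *
          B ^ length (β + β) * ((H ^ length (α + α) * (weight m α * weight m α)) *
            (K ^ length (β + β) * (weight q β * weight q β))) := by
          gcongr
          · nlinarith
          · linarith
          · exact length_mono le_self_add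
          · exact hH2 α α
          · exact hK2 β β
      _ = _ := by
          simp only [length_add, mul_pow, pow_add]
          ring
  exact le_of_sq_le_sq hsq (by positivity)

/-- Sobolev applied to x^α ∂^β φ; its derivatives are estimated by the same Leibniz bound, now for
the L² norm. -/
theorem exists_sup_bounds_of_hasJointL2Bounds (hm : ∀ j p, 0 < m j p) (hq : ∀ j p, 0 < q j p)
    (hm0 : ∀ j, A0 (m j)) (hq0 : ∀ j, A0 (q j)) (hm1 : ∀ j, A1 (m j)) (hq1 : ∀ j, A1 (q j))
    (hq2 : ∀ j, A2 (q j)) (h3 : ∀ j, A3 (m j) (q j))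
    {φ : 𝓢(RN n, ℂ)} (h : HasJointL2Bounds m q φ) :
    ∃ C A B : ℝ, 0 < C ∧ 1 ≤ A ∧ 1 ≤ B ∧ ∀ (x : RN n) (α β : Fin n → ℕ),
      ‖schwartzMonom α (schwartzDeriv β φ) x‖ ≤
        C * A ^ length α * B ^ length β * (weight m α * weight q β) := by
  obtain ⟨C, A, B, hC, hA, hB, h⟩ := h
  obtain ⟨L, hL, hL3⟩ := exists_uniform_A3 hm hq hm0 hq0 hm1 hq1 h3
  obtain ⟨K, hK, hK2⟩ := exists_uniform_A2 hq hq2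
  have hadd (f g : 𝓢(RN n, ℂ)) :
      ‖(f + g).toLp 2 volume‖ ≤ ‖f.toLp 2 volume‖ + ‖g.toLp 2 volume‖ := by
    simp only [← SchwartzMap.toLpCLM_apply (𝕜 := ℝ), map_add]
    exact norm_add_le _ _
  have hsmul (c : ℝ) (f : 𝓢(RN n, ℂ)) (hc : 0 ≤ c) :
      ‖(c • f).toLp 2 volume‖ ≤ c * ‖f.toLp 2 volume‖ := by
    simp only [← SchwartzMap.toLpCLM_apply (𝕜 := ℝ), map_smul, norm_smul, Real.norm_eq_abs,
      abs_of_nonneg hc, le_refl]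
  have key := deriv_monom_deriv_bound hm hq hL hL3 (p := fun f => ‖f.toLp 2 volume‖)
    hadd hsmul hC.le hA hB h
  have hQ0 : 0 ≤ ∑ j, q j (n + 1) := Finset.sum_nonneg fun j _ => (hq j _).le
  -- `Q` dominates `weight q b` for `b = 0` and `b = Pi.single j (n + 1)`, the only orders Sobolev
  -- needs.
  set Q : ℝ := 1 + ∑ j, q j (n + 1) with hQ
  set S : ℝ := (∫ x : RN n, (decayWeight x)⁻¹) + (n + 1) with hS
  have hS0 : 0 < S := by
    have : 0 ≤ ∫ x : RN n, (decayWeight x)⁻¹ := integral_nonneg fun x =>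
      inv_nonneg.mpr (zero_le_one.trans (one_le_decayWeight x))
    positivity
  have hQ1 : 0 < Q := by linarith
  refine ⟨S * (C * (2 * L) ^ (n + 1) * (B * K) ^ (n + 1) * Q), 2 * A, B * K, by positivity,
    by linarith, one_le_mul_of_one_le_of_one_le hB hK, fun x α β => ?_⟩
  have hwm := weight_pos hm α
  have hwq := weight_pos hq β
  have hb (b : Fin n → ℕ) (hlen : length b ≤ n + 1) (hwb : weight q b ≤ Q) :
      ‖(schwartzDeriv b (schwartzMonom α (schwartzDeriv β φ))).toLp 2 volume‖ ≤
        C * (2 * L) ^ (n + 1) * (B * K) ^ (n + 1) * Q * (2 * A) ^ length α *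
          (B * K) ^ length β * (weight m α * weight q β) := by
    have hwb0 := weight_pos hq b
    have hw2 := weight_pos hq (b + β)
    have e1 : (2 * L) ^ length b ≤ (2 * L) ^ (n + 1) := pow_le_pow_right₀ (by linarith) hlen
    have e2 : (B * K) ^ length (b + β) ≤ (B * K) ^ (n + 1 + length β) := by
      refine pow_le_pow_right₀ (one_le_mul_of_one_le_of_one_le hB hK) ?_
      rw [length_add]
      gcongr
    calc _ ≤ C * (2 * A) ^ length α * (2 * L) ^ length b * B ^ length (b + β) *
          (weight m α * weight q (b + β)) := key α b β
      _ ≤ C * (2 * A) ^ length α * (2 * L) ^ length b * B ^ length (b + β) *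
          (weight m α * (K ^ length (b + β) * (weight q b * weight q β))) := by
          gcongr
          exact hK2 b β
      _ = C * (2 * A) ^ length α * (2 * L) ^ length b * (B * K) ^ length (b + β) *
          (weight m α * (weight q b * weight q β)) := by rw [mul_pow B K]; ring
      _ ≤ C * (2 * A) ^ length α * (2 * L) ^ (n + 1) * (B * K) ^ (n + 1 + length β) *
          (weight m α * (Q * weight q β)) := by gcongr
      _ = _ := by rw [pow_add (B * K)]; ring
  have hsob := norm_le_of_L2_bounds (schwartzMonom α (schwartzDeriv β φ))
    (G := C * (2 * L) ^ (n + 1) * (B * K) ^ (n + 1) * Q * (2 * A) ^ length α *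
          (B * K) ^ length β * (weight m α * weight q β)) (by positivity)
    (by simpa using hb 0 (by simp) (by rw [weight_zero hq0]; linarith))
    (fun j => by
      rw [← schwartzDeriv_single]
      refine hb _ (by simp) ?_
      rw [weight_single hq0]
      linarith [Finset.single_le_sum (fun i _ => (hq i (n + 1)).le) (Finset.mem_univ j)]) x
  exact hsob.trans (le_of_eq (by rw [← hS]; ring))

theorem hasJointL2Bounds_of_separateL2 (hm : ∀ j p, 0 < m j p) (hq : ∀ j p, 0 < q j p)
    (hm0 : ∀ j, A0 (m j)) (hq0 : ∀ j, A0 (q j)) (hm1 : ∀ j, A1 (m j)) (hq1 : ∀ j, A1 (q j))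
    (hm2 : ∀ j, A2 (m j)) (hq2 : ∀ j, A2 (q j)) (h3 : ∀ j, A3 (m j) (q j))
    {φ : 𝓢(RN n, ℂ)} (h : SeparateL2Bounds m q φ) : HasJointL2Bounds m q φ := by
  obtain ⟨C, A, B, hC, hA, hB, hα, hβ⟩ := h
  refine hasJointL2Bounds_of_pairing hm hq hm0 hq0 hm1 hq1 hm2 hq2 h3
    (C := C * C) (A := 1 + A) (B := 1 + B) (by positivity) (by linarith) (by linarith)
    fun α β => ?_
  have hwm := weight_pos hm α
  have hwq := weight_pos hq β
  have h1 : ‖(schwartzMonom α φ).toLp 2 volume‖ ≤ C * A ^ length α * weight m α := by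
    rw [← l2norm_le_ofReal_iff _ (by positivity), coe_schwartzMonom]
    exact hα α
  have h2 : ‖(schwartzDeriv β φ).toLp 2 volume‖ ≤ C * B ^ length β * weight q β := by
    rw [← l2norm_le_ofReal_iff _ (by positivity), coe_schwartzDeriv]
    exact hβ β
  rw [pairing_monom]
  calc |pairing (schwartzDeriv β φ) (schwartzMonom α φ)|
      ≤ ‖(schwartzDeriv β φ).toLp 2 volume‖ * ‖(schwartzMonom α φ).toLp 2 volume‖ :=
        abs_pairing_le _ _
    _ ≤ (C * B ^ length β * weight q β) * (C * A ^ length α * weight m α) := by gcongr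
    _ ≤ (C * (1 + B) ^ length β * weight q β) * (C * (1 + A) ^ length α * weight m α) := by
        gcongr <;> linarith
    _ = _ := by ring

/-- The pairing is at most the sup norm of ∂^β φ times the L¹ norm of x^α φ; the latter follows from
sup bounds at α and α + (2n+2)e_j, which (A2) reduces to `weight m α`. -/
theorem hasJointL2Bounds_of_separateSup (hm : ∀ j p, 0 < m j p) (hq : ∀ j p, 0 < q j p)
    (hm0 : ∀ j, A0 (m j)) (hq0 : ∀ j, A0 (q j)) (hm1 : ∀ j, A1 (m j)) (hq1 : ∀ j, A1 (q j))
    (hm2 : ∀ j, A2 (m j)) (hq2 : ∀ j, A2 (q j)) (h3 : ∀ j, A3 (m j) (q j))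
    {φ : 𝓢(RN n, ℂ)} (h : SeparateSupBounds m q φ) : HasJointL2Bounds m q φ := by
  obtain ⟨C, A, B, hC, hA, hB, hα, hβ⟩ := h
  obtain ⟨H, hH, hH2⟩ := exists_uniform_A2 hm hm2
  set S : ℝ := ∫ x : RN n, (decayWeight x)⁻¹ with hS
  have hS0 : 0 ≤ S := integral_nonneg fun x =>
    inv_nonneg.mpr (zero_le_one.trans (one_le_decayWeight x))
  have hQ0 : 0 ≤ ∑ j, m j (2 * n + 2) := Finset.sum_nonneg fun j _ => (hm j _).le
  set Q : ℝ := 1 + ∑ j, m j (2 * n + 2) with hQ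
  have hA1 : 1 ≤ 1 + A := by linarith
  set E : ℝ := (1 + A) * H with hE
  have hE1 : 1 ≤ E := one_le_mul_of_one_le_of_one_le hA1 hH
  have hQ1 : 0 < Q := by linarith
  refine hasJointL2Bounds_of_pairing hm hq hm0 hq0 hm1 hq1 hm2 hq2 h3
    -- `1 + S` replaces `S`, which is only known to be nonnegative, to keep the constant positive.
    (C := C * (((n : ℝ) + 1) * (C * E ^ (2 * n + 2) * Q) * (1 + S)))
    (A := E) (B := 1 + B) (by positivity) hE1 (by linarith) fun α β => ?_
  have hwm := weight_pos hm α
  have hwq := weight_pos hq β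
  have hb (b : Fin n → ℕ) (hlen : length b ≤ 2 * n + 2) (hwb : weight m b ≤ Q) (x : RN n) :
      ‖schwartzMonom (b + α) φ x‖ ≤ C * E ^ (2 * n + 2) * Q * E ^ length α * weight m α := by
    have hwb0 := weight_pos hm b
    have hw2 := weight_pos hm (b + α)
    have e2 : E ^ length (b + α) ≤ E ^ (2 * n + 2 + length α) := by
      refine pow_le_pow_right₀ hE1 ?_
      rw [length_add]
      gcongr
    rw [schwartzMonom_apply]
    calc _ ≤ C * A ^ length (b + α) * weight m (b + α) := hα _ x
      _ ≤ C * (1 + A) ^ length (b + α) * (H ^ length (b + α) * (weight m b * weight m α)) := by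
          gcongr
          · linarith
          · exact hH2 b α
      _ = C * E ^ length (b + α) * (weight m b * weight m α) := by rw [hE, mul_pow]; ring
      _ ≤ C * E ^ (2 * n + 2 + length α) * (Q * weight m α) := by gcongr
      _ = _ := by rw [pow_add]; ring
  have hint := integral_norm_le_of_decay (schwartzMonom α φ)
    (M := C * E ^ (2 * n + 2) * Q * E ^ length α * weight m α)
    (fun x => by simpa using hb 0 (by simp) (by rw [weight_zero hm0]; linarith) x)
    (fun j x => by
      rw [schwartzMonom_schwartzMonom]
      refine hb _ (by simp) ?_ x
      rw [weight_single hm0]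
      linarith [Finset.single_le_sum (fun i _ => (hm i (2 * n + 2)).le) (Finset.mem_univ j)])
  have hsup (x : RN n) : ‖schwartzDeriv β φ x‖ ≤ C * (1 + B) ^ length β * weight q β := by
    rw [coe_schwartzDeriv]
    refine (hβ β x).trans ?_
    gcongr
    linarith
  rw [pairing_monom]
  calc |pairing (schwartzDeriv β φ) (schwartzMonom α φ)|
      ≤ C * (1 + B) ^ length β * weight q β * ∫ x, ‖schwartzMonom α φ x‖ :=
        abs_pairing_le_of_bound hsup
    _ ≤ C * (1 + B) ^ length β * weight q β *
        (((n : ℝ) + 1) * (C * E ^ (2 * n + 2) * Q * E ^ length α * weight m α) * (1 + S)) := by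
        refine mul_le_mul_of_nonneg_left (hint.trans ?_) (by positivity)
        rw [← hS]
        gcongr
        linarith
    _ = _ := by ring

/-! ### Translation to the stated forms of the bounds -/

@[simp]
theorem multiDeriv_zero (φ : RN n → ℂ) : multiDeriv 0 φ = φ := by
  unfold multiDeriv
  induction List.finRange n with
  | nil => rfl
  | cons j l ih => rw [List.foldr_cons, ih]; rfl

theorem coe_schwartzMonom_schwartzDeriv (α β : Fin n → ℕ) (φ : 𝓢(RN n, ℂ)) :
    ⇑(schwartzMonom α (schwartzDeriv β φ)) = fun x => monom α x • multiDeriv β φ x := by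
  rw [coe_schwartzMonom, coe_schwartzDeriv]

theorem HasJointL2Bounds.jointL2Bounds (hm : ∀ j p, 0 < m j p) (hq : ∀ j p, 0 < q j p)
    {φ : 𝓢(RN n, ℂ)} (h : HasJointL2Bounds m q φ) : JointL2Bounds m q φ := by
  obtain ⟨C, A, B, hC, hA, hB, h⟩ := h
  refine ⟨C, A, B, hC, by linarith, by linarith, fun α β => ?_⟩
  have hwm := weight_pos hm α
  have hwq := weight_pos hq β
  rw [← coe_schwartzMonom_schwartzDeriv, l2norm_le_ofReal_iff _ (by positivity),
    mul_assoc _ _ (weight q β)]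
  exact h α β

theorem JointL2Bounds.separateL2Bounds (hm0 : ∀ j, A0 (m j)) (hq0 : ∀ j, A0 (q j))
    {φ : RN n → ℂ} (h : JointL2Bounds m q φ) : SeparateL2Bounds m q φ := by
  obtain ⟨C, A, B, hC, hA, hB, h⟩ := h
  refine ⟨C, A, B, hC, hA, hB, fun α => ?_, fun β => ?_⟩
  · simpa [weight_zero hq0] using h α 0
  · simpa [weight_zero hm0] using h 0 β

theorem separateSupBounds_of_mem_gsrSpace (hm0 : ∀ j, A0 (m j)) (hq0 : ∀ j, A0 (q j))
    {φ : RN n → ℂ} (h : φ ∈ gsrSpace m q) : SeparateSupBounds m q φ := by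
  obtain ⟨-, C, A, B, hC, hA, hB, h⟩ := h
  refine ⟨C, A, B, hC, hA, hB, fun α x => ?_, fun β x => ?_⟩
  · simpa [weight_zero hq0] using h x α 0
  · simpa [weight_zero hm0] using h x 0 β

end GSR
end

theorem mainTheorem4 (n : ℕ) (m q : Fin n → ℕ → ℝ)
    (hm_pos : ∀ j p, 0 < m j p) (hq_pos : ∀ j p, 0 < q j p)
    (hm0 : ∀ j, GSR.A0 (m j)) (hq0 : ∀ j, GSR.A0 (q j))
    (hm1 : ∀ j, GSR.A1 (m j)) (hq1 : ∀ j, GSR.A1 (q j))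
    (hm2 : ∀ j, GSR.A2 (m j)) (hq2 : ∀ j, GSR.A2 (q j))
    (h3 : ∀ j, GSR.A3 (m j) (q j)) :
    (∀ φ : GSR.RN n → ℂ,
      φ ∈ GSR.gsrSpace m q ↔ GSR.IsSchwartz φ ∧ GSR.SeparateSupBounds m q φ) ∧
    (∀ φ : GSR.RN n → ℂ, GSR.IsSchwartz φ →
      (GSR.JointL2Bounds m q φ ↔ GSR.SeparateL2Bounds m q φ)) := by
  refine ⟨fun φ => ⟨fun h => ⟨h.1, GSR.separateSupBounds_of_mem_gsrSpace hm0 hq0 h⟩, ?_⟩, ?_⟩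
  · rintro ⟨⟨f, rfl⟩, h⟩
    obtain ⟨C, A, B, hC, hA, hB, hbound⟩ :=
      GSR.exists_sup_bounds_of_hasJointL2Bounds hm_pos hq_pos hm0 hq0 hm1 hq1 hq2 h3
        (GSR.hasJointL2Bounds_of_separateSup hm_pos hq_pos hm0 hq0 hm1 hq1 hm2 hq2 h3 h)
    refine ⟨⟨f, rfl⟩, C, A, B, hC, by linarith, by linarith, fun x α β => ?_⟩
    have := hbound x α β
    rwa [GSR.coe_schwartzMonom_schwartzDeriv, ← mul_assoc] at this
  · rintro _ ⟨f, rfl⟩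
    exact ⟨fun h => h.separateL2Bounds hm0 hq0, fun h =>
      (GSR.hasJointL2Bounds_of_separateL2 hm_pos hq_pos hm0 hq0 hm1 hq1 hm2 hq2 h3 h).jointL2Bounds
        hm_pos hq_pos⟩
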